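/- Let $\mathbb{R}^n$ carry its Euclidean inner product and norm (and the induced operator norms on linear and multilinear maps), let $B(a,\delta)$ denote the open ball, let $\Omega\subset\mathbb{R}^n$ be open, $C\subset\Omega$ convex and compact, and $F:\Omega\to\mathbb{R}^n$ analytic. Let $x_*\in C$ satisfy $F(x_*)=0$ with $F'(x_*)$ nonsingular, and assume $$\gamma:=\sup_{m>1}\left\|\frac{F'(x_*)^{-1}F^{(m)}(x_*)}{m!}\right\|^{1/(m-1)}<+\infty .$$ **CondG procedure** $z=\mathrm{CondG}(y,x,\varepsilon)$, for $x\in C$, $\varepsilon\ge 0$. Put $z_1=x$. For $t=1,2,\dots$, let $u_t$ be any minimizer of $u\mapsto\langle z_t-y,u-z_t\rangle$ over $C$ and $g_t^*$ the minimum. If $g_t^*\ge-\varepsilon$, stop with output $z=z_t$; otherwise set $z_{t+1}=z_t+\alpha_t(u_t-z_t)$ with $\alpha_t=\min\{1,-g_t^*/\|u_t-z_t\|^2\}$. If the procedure never stops, its output is understood to be $\lim_t z_t$. **Newton-CondG method.** Given $x_0\in C$ and $\{\theta_k\}\subset[0,\infty)$, for $k=0,1,\dots$: if $F(x_k)=0$,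 stop (we then put $x_j=x_k$ for all $j\ge k$); otherwise find $s_k$ with $F'(x_k)s_k=-F(x_k)$ and take $x_{k+1}=\mathrm{CondG}(x_k+s_k,x_k,\theta_k\|s_k\|^2)$. Let $\lambda\in[0,1)$, $\kappa=\sup\{t\in[0,1/\gamma):B(x_*,t)\subset\Omega\}$ and $$\bar r=\min\left\{\kappa,\ \frac{5-3\lambda-\sqrt{(5-3\lambda)^2-8(1-\lambda)^2}}{4(1-\lambda)\gamma}\right\},$$ where $c/0=+\infty$ for $c>0$ if $\gamma=0$. Assume that $\{\theta_k\}\subset[0,\lambda^2/2]$ and $x_0\in (C\cap B(x_*,\bar r))\setminus\{x_*\}$. Then: 1. The method is well defined, whatever minimizers $u_t$ are chosen: at every iterate $x_k$ reached, $F'(x_k)$ is nonsingular; if $F(x_k)\neq0$, then $s_k\ne0$ and the CondG procedure at step $k$ stops after finitely many passes if $\theta_k>0$, and in general (so also if $\theta_k=0$) it either stops after finitely many passes or its inner iterates $z_t$ converge. Hence the method generates a sequence $\{x_k\}$. 2. Every sequence $\{x_k\}$ so generated is contained in $B(x_*,\bar r)\cap C$, converges to $x_*$, and satisfies, for all $k\ge0$,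 $$\|x_{k+1}-x_*\|\le\frac{\gamma}{2(1-\gamma\|x_0-x_*\|)^2-1}\,\|x_k-x_*\|^2+\sqrt{2\theta_k}\,\|x_k-x_*\| .$$ Moreover, if $t_0=\|x_0-x_*\|$, then for all $k\ge0$ $$\|x_{k+1}-x_*\|\le t_{k+1}:=\frac{(1+\lambda)\gamma t_k^2}{2(1-\gamma t_k)^2-1}+\sqrt{2\theta_k}\,t_k .$$ -/

import Mathlib

open Filter Topology
open scoped ENNReal

/-- The space `ℝⁿ` with its standard inner product and the associated norm. -/
abbrev RSpace (n : ℕ) : Type := EuclideanSpace ℝ (Fin n)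

section CondG

variable {n : ℕ}

/-- `u` is an answer of the linear optimization oracle at `z`: a minimizer over `C` of the linear
functional `v ↦ ⟪z - y, v - z⟫`. -/
def IsLOSolution (C : Set (RSpace n)) (y z u : RSpace n) : Prop :=
  u ∈ C ∧ ∀ v ∈ C, inner ℝ (z - y) (u - z) ≤ inner ℝ (z - y) (v - z)

/-- The stopping test of the CondG procedure succeeds at `z`: the minimum `g* = ⟪z - y, u - z⟫`
satisfies `g* ≥ -ε`. -/
def CondGStops (C : Set (RSpace n)) (y : RSpace n) (ε : ℝ) (z : RSpace n) : Prop :=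
  ∃ u, IsLOSolution C y z u ∧ -ε ≤ inner ℝ (z - y) (u - z)

/-- One pass through the loop of the CondG procedure, from `z` to `z'`: the stopping test fails
(`g* < -ε`) and `z' = z + α (u - z)` with `α = min {1, -g* / ‖u - z‖²}`. -/
def CondGStep (C : Set (RSpace n)) (y : RSpace n) (ε : ℝ) (z z' : RSpace n) : Prop :=
  ∃ u, IsLOSolution C y z u ∧ inner ℝ (z - y) (u - z) < -ε ∧
    z' = z + min 1 (-inner ℝ (z - y) (u - z) / ‖u - z‖ ^ 2) • (u - z)

/-- `z` is the (infinite) sequence of inner iterates of an execution of the CondG procedure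
started at `x` which never stops. -/
def IsInfiniteCondGRun (C : Set (RSpace n)) (y x : RSpace n) (ε : ℝ) (z : ℕ → RSpace n) : Prop :=
  z 0 = x ∧ ∀ t, CondGStep C y ε (z t) (z (t + 1))

/-- `w` is an output `CondG(y, x, ε)` of the CondG procedure, for some choice of the answers of the
linear optimization oracle: either the procedure, started at `x`, reaches `w` after finitely many
passes and stops there, or it never stops and its inner iterates converge to `w`. -/
def IsCondGOutput (C : Set (RSpace n)) (y x : RSpace n) (ε : ℝ) (w : RSpace n) : Prop :=
  (Relation.ReflTransGen (CondGStep C y ε) x w ∧ CondGStops C y ε w) ∨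
    ∃ z : ℕ → RSpace n, IsInfiniteCondGRun C y x ε z ∧ Tendsto z atTop (𝓝 w)

/-- The call `CondG(y, x, ε)` is well defined, whatever the answers of the oracle are: the procedure
never gets stuck, it stops after finitely many passes if `ε > 0`, and if an execution does not stop
then its inner iterates converge. -/
structure CondGWellDefined (C : Set (RSpace n)) (y x : RSpace n) (ε : ℝ) : Prop where
  progress : ∀ z, Relation.ReflTransGen (CondGStep C y ε) x z →
    CondGStops C y ε z ∨ ∃ z', CondGStep C y ε z z'
  terminates : 0 < ε → ¬ ∃ z : ℕ → RSpace n, IsInfiniteCondGRun C y x ε z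
  converges : ∀ z : ℕ → RSpace n, IsInfiniteCondGRun C y x ε z →
    ∃ w, Tendsto z atTop (𝓝 w)

/-- `x'` is an iterate following `x` in the Newton-CondG method with parameter `θ`: if `F x = 0`
the method stops, and the last iterate is repeated; otherwise a Newton step `F'(x) s = -F(x)`,
`y = x + s`, is followed by `x' = CondG(y, x, θ ‖s‖²)`. -/
def NewtonCondGStep (F : RSpace n → RSpace n) (C : Set (RSpace n)) (θ : ℝ)
    (x x' : RSpace n) : Prop :=
  (F x = 0 ∧ x' = x) ∨
    (F x ≠ 0 ∧ ∃ s : RSpace n, fderiv ℝ F x s = -F x ∧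
      IsCondGOutput C (x + s) x (θ * ‖s‖ ^ 2) x')

/-- `κ(Ω, R) = sup {t ∈ [0, R) : B(a, t) ⊆ Ω}`. -/
noncomputable def kappa (Ω : Set (RSpace n)) (a : RSpace n) (R : ℝ≥0∞) : ℝ≥0∞ :=
  sSup {t : ℝ≥0∞ | t < R ∧ Metric.eball a t ⊆ Ω}

/-- The Smale constant `sup_{m > 1} ‖F'(a)⁻¹ F⁽ᵐ⁾(a) / m!‖ ^ (1 / (m - 1))`, as an extended
nonnegative real number; the norm is the operator norm of `m`-linear maps. -/
noncomputable def smaleGamma (F : RSpace n → RSpace n) (a : RSpace n) : ℝ≥0∞ :=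
  ⨆ (m : ℕ) (_ : 1 < m),
    ‖((m.factorial : ℝ)⁻¹ • (fderiv ℝ F a).inverse.compContinuousMultilinearMap
        (iteratedFDeriv ℝ m F a))‖ₑ ^ (1 / ((m : ℝ) - 1))

/-- The radius `r̄ = min {κ(Ω, 1/γ), (5 - 3λ - √((5 - 3λ)² - 8(1 - λ)²)) / (4 (1 - λ) γ)}`, with the
convention `c / 0 = ∞` for `c > 0`. -/
noncomputable def smaleRadius (Ω : Set (RSpace n)) (a : RSpace n) (γ : ℝ≥0∞) (lam : ℝ) : ℝ≥0∞ :=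
  min (kappa Ω a (1 / γ))
    (ENNReal.ofReal (5 - 3 * lam - √((5 - 3 * lam) ^ 2 - 8 * (1 - lam) ^ 2)) /
      (ENNReal.ofReal (4 * (1 - lam)) * γ))

end CondG

/-- The scalar sequence `t_{k+1} = (1 + λ) γ t_k² / (2 (1 - γ t_k)² - 1) + √(2 θ_k) t_k`. -/
noncomputable def smaleSeq (γ lam : ℝ) (θ : ℕ → ℝ) (t₀ : ℝ) : ℕ → ℝ
  | 0 => t₀
  | k + 1 => (1 + lam) * γ * smaleSeq γ lam θ t₀ k ^ 2 /
        (2 * (1 - γ * smaleSeq γ lam θ t₀ k) ^ 2 - 1)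
      + √(2 * θ k) * smaleSeq γ lam θ t₀ k

/-!
A CondG output `w` satisfies `⟪w - y, w - v⟫ ≤ ε` for all `v ∈ C`, so
`‖w - x*‖² ≤ ‖y - x*‖² + 2 ε`; the procedure converges because the Frank–Wolfe gap is controlled by
the decrease of `‖z - y‖²`. By definition of `γ`, the Taylor coefficients of `F'(x*)⁻¹ F` at `x*`
are majorized by those of a geometric series, which makes `F'(x)` invertible and bounds the error of
the Newton step at distance `t` from `x*` by `N = γ t² / (2 (1 - γ t)² - 1)`. Below `r̄` one has
`(1 + λ) N < (1 - λ) t`, and this inequality both turns the square-root bound on the CondG output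
into `N + √(2 θ) t` and makes the right-hand side a contraction.
-/

open scoped NNReal

section InnerProduct

variable {E : Type*} [NormedAddCommGroup E] [InnerProductSpace ℝ E]

lemma norm_add_smul_sq (p d : E) (α : ℝ) :
    ‖p + α • d‖ ^ 2 = ‖p‖ ^ 2 + 2 * α * inner ℝ p d + α ^ 2 * ‖d‖ ^ 2 := by
  rw [norm_add_sq_real, inner_smul_right, norm_smul, mul_pow, Real.norm_eq_abs, sq_abs]
  ring

-- The first term of the bound is for the full step, the second for the exact line search.
lemma neg_inner_le_add_mul_sqrt (p d : E) :
    -inner ℝ p d ≤ (‖p‖ ^ 2 - ‖p + min 1 (-inner ℝ p d / ‖d‖ ^ 2) • d‖ ^ 2) +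
      ‖d‖ * √(‖p‖ ^ 2 - ‖p + min 1 (-inner ℝ p d / ‖d‖ ^ 2) • d‖ ^ 2) := by
  rcases eq_or_ne d 0 with rfl | hd
  · simp
  rcases le_total 1 (-inner ℝ p d / ‖d‖ ^ 2) with hfull | hshort
  · have hdecrease : -inner ℝ p d ≤ ‖p‖ ^ 2 - ‖p + (1 : ℝ) • d‖ ^ 2 := by
      rw [le_div_iff₀ (by positivity)] at hfull
      rw [norm_add_smul_sq]
      linarith
    rw [min_eq_left hfull]
    exact hdecrease.trans (le_add_of_nonneg_right (by positivity))
  · have hdecrease : ‖p‖ ^ 2 - ‖p + (-inner ℝ p d / ‖d‖ ^ 2) • d‖ ^ 2 =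
        (-inner ℝ p d / ‖d‖) ^ 2 := by
      rw [norm_add_smul_sq]
      field_simp
      ring
    rw [min_eq_right hshort, hdecrease, Real.sqrt_sq_eq_abs]
    calc -inner ℝ p d = ‖d‖ * (-inner ℝ p d / ‖d‖) := by field_simp
      _ ≤ ‖d‖ * |-inner ℝ p d / ‖d‖| := by gcongr; exact le_abs_self _
      _ ≤ _ := le_add_of_nonneg_left (sq_nonneg _)

lemma exists_forall_inner_nonneg {C : Set E} (hC : Convex ℝ C) (hcomplete : IsComplete C)
    (hne : C.Nonempty) (y : E) : ∃ p ∈ C, ∀ v ∈ C, 0 ≤ inner ℝ (p - y) (v - p) := by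
  obtain ⟨p, hp, hmin⟩ := exists_norm_eq_iInf_of_complete_convex hne hcomplete hC y
  refine ⟨p, hp, fun v hv => ?_⟩
  have hobtuse := (norm_eq_iInf_iff_real_inner_le_zero hC hp).1 hmin v hv
  rw [← neg_sub y p, inner_neg_left]
  linarith

end InnerProduct

lemma exists_seq_of_forall_mem_exists {α : Type*} {K : Set α} {R : ℕ → α → α → Prop}
    (hR : ∀ k, ∀ x ∈ K, ∃ x' ∈ K, R k x x') {x₀ : α} (hx₀ : x₀ ∈ K) :
    ∃ x : ℕ → α, x 0 = x₀ ∧ ∀ k, R k (x k) (x (k + 1)) := by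
  choose! f hfK hfR using hR
  let x : ℕ → α := fun k => Nat.rec x₀ f k
  have hx : ∀ k, x k ∈ K := fun k => Nat.rec hx₀ (fun k ih => hfK k _ ih) k
  exact ⟨x, rfl, fun k => hfR k _ (hx k)⟩

section CondG

variable {n : ℕ} {C : Set (RSpace n)} {x y z z' u v w : RSpace n} {ε : ℝ}

lemma CondGStep.mem (hC : Convex ℝ C) (hε : 0 ≤ ε) (hz : z ∈ C) (h : CondGStep C y ε z z') :
    z' ∈ C := by
  obtain ⟨u, hu, hg, rfl⟩ := h
  refine hC.add_smul_sub_mem hz hu.1 ⟨le_min zero_le_one ?_, min_le_left _ _⟩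
  exact div_nonneg (by linarith) (sq_nonneg _)

lemma CondGStep.mem_of_reflTransGen (hC : Convex ℝ C) (hε : 0 ≤ ε) (hx : x ∈ C)
    (h : Relation.ReflTransGen (CondGStep C y ε) x z) : z ∈ C := by
  induction h with
  | refl => exact hx
  | tail _ hstep ih => exact hstep.mem hC hε ih

lemma IsInfiniteCondGRun.mem (hC : Convex ℝ C) (hε : 0 ≤ ε) (hx : x ∈ C) {z : ℕ → RSpace n}
    (h : IsInfiniteCondGRun C y x ε z) (t : ℕ) : z t ∈ C := by
  induction t with
  | zero => rwa [h.1]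
  | succ t ih => exact (h.2 t).mem hC hε ih

lemma exists_isLOSolution (hC : IsCompact C) (hne : C.Nonempty) (y z : RSpace n) :
    ∃ u, IsLOSolution C y z u :=
  hC.exists_isMinOn hne (f := fun v => inner ℝ (z - y) (v - z)) (by fun_prop)

lemma condGStops_or_exists_condGStep (hC : IsCompact C) (hne : C.Nonempty) (y z : RSpace n)
    (ε : ℝ) : CondGStops C y ε z ∨ ∃ z', CondGStep C y ε z z' := by
  obtain ⟨u, hu⟩ := exists_isLOSolution hC hne y z
  rcases le_or_gt (-ε) (inner ℝ (z - y) (u - z)) with hstops | hcontinue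
  · exact Or.inl ⟨u, hu, hstops⟩
  · exact Or.inr ⟨_, u, hu, hcontinue, rfl⟩

/-- The Frank–Wolfe gap `max {⟪z - y, z - v⟫ | v ∈ C}`, which is `-g*` for the minimum `g*` computed
by the linear optimization oracle at `z`. -/
noncomputable def condGGap (C : Set (RSpace n)) (y z : RSpace n) : ℝ :=
  sSup ((fun v => inner ℝ (z - y) (z - v)) '' C)

lemma IsLOSolution.condGGap_eq (h : IsLOSolution C y z u) :
    condGGap C y z = -inner ℝ (z - y) (u - z) := by
  have hgreatest : IsGreatest ((fun v => inner ℝ (z - y) (z - v)) '' C)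
      (inner ℝ (z - y) (z - u)) := by
    refine ⟨⟨u, h.1, rfl⟩, ?_⟩
    rintro _ ⟨v, hv, rfl⟩
    beta_reduce
    rw [← neg_sub v, ← neg_sub u, inner_neg_right, inner_neg_right]
    exact neg_le_neg (h.2 v hv)
  rw [condGGap, hgreatest.csSup_eq, ← neg_sub u, inner_neg_right]

lemma IsLOSolution.inner_le_condGGap (h : IsLOSolution C y z u) (hv : v ∈ C) :
    inner ℝ (z - y) (z - v) ≤ condGGap C y z := by
  rw [h.condGGap_eq, ← neg_sub v, inner_neg_right]
  exact neg_le_neg (h.2 v hv)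

lemma CondGStep.inner_le_condGGap (h : CondGStep C y ε z z') (hv : v ∈ C) :
    inner ℝ (z - y) (z - v) ≤ condGGap C y z :=
  let ⟨_, hu, _⟩ := h
  hu.inner_le_condGGap hv

lemma CondGStep.lt_condGGap (h : CondGStep C y ε z z') : ε < condGGap C y z := by
  obtain ⟨u, hu, hg, -⟩ := h
  rw [hu.condGGap_eq]
  exact lt_neg_of_lt_neg hg

lemma CondGStep.condGGap_le (hC : Bornology.IsBounded C) (hz : z ∈ C)
    (h : CondGStep C y ε z z') :
    condGGap C y z ≤ (‖z - y‖ ^ 2 - ‖z' - y‖ ^ 2) +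
      Metric.diam C * √(‖z - y‖ ^ 2 - ‖z' - y‖ ^ 2) := by
  obtain ⟨u, hu, -, rfl⟩ := h
  have hdiam : ‖u - z‖ ≤ Metric.diam C := dist_eq_norm u z ▸ Metric.dist_le_diam_of_mem hC hu.1 hz
  rw [hu.condGGap_eq, add_sub_right_comm z]
  exact (neg_inner_le_add_mul_sqrt _ _).trans (by gcongr)

lemma CondGStep.norm_sub_sq_le (hC : Bornology.IsBounded C) (hε : 0 ≤ ε) (hz : z ∈ C)
    (h : CondGStep C y ε z z') : ‖z' - y‖ ^ 2 ≤ ‖z - y‖ ^ 2 := by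
  by_contra! hlt
  have hgap := h.condGGap_le hC hz
  rw [Real.sqrt_eq_zero_of_nonpos (by linarith)] at hgap
  linarith [h.lt_condGGap]

lemma IsInfiniteCondGRun.tendsto_condGGap (hC : Convex ℝ C) (hcomp : IsCompact C) (hε : 0 ≤ ε)
    (hx : x ∈ C) {z : ℕ → RSpace n} (h : IsInfiniteCondGRun C y x ε z) :
    Tendsto (fun t => condGGap C y (z t)) atTop (𝓝 0) := by
  have hmem := h.mem hC hε hx
  have hanti : Antitone fun t => ‖z t - y‖ ^ 2 :=
    antitone_nat_of_succ_le fun t => (h.2 t).norm_sub_sq_le hcomp.isBounded hε (hmem t)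
  have hlim := tendsto_atTop_ciInf hanti ⟨0, by rintro _ ⟨t, rfl⟩; positivity⟩
  have hdecrease : Tendsto (fun t => ‖z t - y‖ ^ 2 - ‖z (t + 1) - y‖ ^ 2) atTop (𝓝 0) := by
    simpa using hlim.sub (hlim.comp (tendsto_add_atTop_nat 1))
  have hmajorant := hdecrease.add (hdecrease.sqrt.const_mul (Metric.diam C))
  simp only [Real.sqrt_zero, mul_zero, add_zero] at hmajorant
  exact squeeze_zero (fun t => hε.trans (h.2 t).lt_condGGap.le)
    (fun t => (h.2 t).condGGap_le hcomp.isBounded (hmem t)) hmajorant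

lemma IsInfiniteCondGRun.exists_tendsto (hC : Convex ℝ C) (hcomp : IsCompact C) (hε : 0 ≤ ε)
    (hx : x ∈ C) {z : ℕ → RSpace n} (h : IsInfiniteCondGRun C y x ε z) :
    ∃ w, Tendsto z atTop (𝓝 w) := by
  obtain ⟨p, hp, hproj⟩ := exists_forall_inner_nonneg hC hcomp.isComplete ⟨x, hx⟩ y
  have hsq (t : ℕ) : ‖z t - p‖ ^ 2 ≤ condGGap C y (z t) :=
    calc ‖z t - p‖ ^ 2 = inner ℝ (z t - y) (z t - p) - inner ℝ (p - y) (z t - p) := by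
          rw [← inner_sub_left, sub_sub_sub_cancel_right, real_inner_self_eq_norm_sq]
      _ ≤ inner ℝ (z t - y) (z t - p) := sub_le_self _ (hproj _ (h.mem hC hε hx t))
      _ ≤ condGGap C y (z t) := (h.2 t).inner_le_condGGap hp
  have hnorm : Tendsto (fun t => ‖z t - p‖ ^ 2) atTop (𝓝 0) :=
    squeeze_zero (fun t => sq_nonneg _) hsq (h.tendsto_condGGap hC hcomp hε hx)
  refine ⟨p, tendsto_iff_norm_sub_tendsto_zero.2 ?_⟩
  simpa using hnorm.sqrt

lemma condGWellDefined_of_isCompact (hC : Convex ℝ C) (hcomp : IsCompact C) (hε : 0 ≤ ε)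
    (hx : x ∈ C) : CondGWellDefined C y x ε where
  progress z _ := condGStops_or_exists_condGStep hcomp ⟨x, hx⟩ y z ε
  terminates := by
    rintro hpos ⟨z, hz⟩
    exact hpos.not_ge (ge_of_tendsto' (hz.tendsto_condGGap hC hcomp hε hx)
      fun t => (hz.2 t).lt_condGGap.le)
  converges _ hz := hz.exists_tendsto hC hcomp hε hx

lemma CondGWellDefined.exists_isCondGOutput (h : CondGWellDefined C y x ε) :
    ∃ w, IsCondGOutput C y x ε w := by
  by_cases hstops : ∃ w, Relation.ReflTransGen (CondGStep C y ε) x w ∧ CondGStops C y ε w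
  · obtain ⟨w, hw⟩ := hstops
    exact ⟨w, Or.inl hw⟩
  · push Not at hstops
    obtain ⟨z, hz⟩ : ∃ z, IsInfiniteCondGRun C y x ε z := by
      refine exists_seq_of_forall_mem_exists
        (K := {z | Relation.ReflTransGen (CondGStep C y ε) x z}) (fun _ z hz => ?_) .refl
      obtain ⟨z', hz'⟩ := (h.progress z hz).resolve_left (hstops z hz)
      exact ⟨z', hz.tail hz', hz'⟩
    obtain ⟨w, hw⟩ := h.converges z hz
    exact ⟨w, Or.inr ⟨z, hz, hw⟩⟩

namespace IsCondGOutput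

lemma mem (hC : Convex ℝ C) (hcomp : IsCompact C) (hε : 0 ≤ ε) (hx : x ∈ C)
    (h : IsCondGOutput C y x ε w) : w ∈ C := by
  rcases h with ⟨h, -⟩ | ⟨z, hz, hlim⟩
  · exact CondGStep.mem_of_reflTransGen hC hε hx h
  · exact hcomp.isClosed.mem_of_tendsto hlim (.of_forall (hz.mem hC hε hx))

lemma inner_le (hC : Convex ℝ C) (hcomp : IsCompact C) (hε : 0 ≤ ε) (hx : x ∈ C)
    (h : IsCondGOutput C y x ε w) (hv : v ∈ C) : inner ℝ (w - y) (w - v) ≤ ε := by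
  rcases h with ⟨-, u, hu, hstops⟩ | ⟨z, hz, hlim⟩
  · calc inner ℝ (w - y) (w - v) ≤ condGGap C y w := hu.inner_le_condGGap hv
      _ ≤ ε := hu.condGGap_eq.trans_le (neg_le.1 hstops)
  · refine le_trans (le_of_tendsto_of_tendsto' ?_ (hz.tendsto_condGGap hC hcomp hε hx)
      fun t => (hz.2 t).inner_le_condGGap hv) hε
    exact (hlim.sub_const y).inner (hlim.sub_const v)

lemma norm_sub_sq_le (hC : Convex ℝ C) (hcomp : IsCompact C) (hε : 0 ≤ ε) (hx : x ∈ C)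
    (h : IsCondGOutput C y x ε w) (hv : v ∈ C) : ‖w - v‖ ^ 2 ≤ ‖y - v‖ ^ 2 + 2 * ε := by
  have hinner := h.inner_le hC hcomp hε hx hv
  have hexpand : ‖y - v‖ ^ 2 = ‖w - v‖ ^ 2 - 2 * inner ℝ (w - y) (w - v) + ‖w - y‖ ^ 2 := by
    rw [← sub_sub_sub_cancel_left v y w, norm_sub_sq_real, real_inner_comm]
  linarith [sq_nonneg ‖w - y‖]

end IsCondGOutput

end CondG

lemma hasSum_succ_mul_geometric {u : ℝ} (hu : ‖u‖ < 1) :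
    HasSum (fun m : ℕ => ((m : ℝ) + 1) * u ^ m) (1 / (1 - u) ^ 2) := by
  simpa using hasSum_choose_mul_geometric_of_norm_lt_one 1 hu

section PowerSeries

variable {𝕜 E G : Type*} [NontriviallyNormedField 𝕜] [NormedAddCommGroup E] [NormedSpace 𝕜 E]
  [NormedAddCommGroup G] [NormedSpace 𝕜 G]

lemma norm_derivSeries_le (p : FormalMultilinearSeries 𝕜 E G) (m : ℕ) :
    ‖p.derivSeries m‖ ≤ (m + 1) * ‖p (m + 1)‖ := by
  have hcurry : ‖p.derivSeries m‖ = ‖p.changeOriginSeries 1 m‖ :=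
    LinearIsometry.norm_compContinuousMultilinearMap
      (continuousMultilinearCurryFin1 𝕜 E G).toLinearIsometry _
  have hcount := NNReal.coe_le_coe.2 (p.nnnorm_changeOriginSeries_le_tsum 1 m)
  rw [hcurry, Nat.add_comm m 1]
  simpa [tsum_fintype, Fintype.card_finset_len, Nat.choose_symm_add, add_comm] using hcount

lemma inv_le_radius_of_norm_le_pow {q : FormalMultilinearSeries 𝕜 E G} {c : ℝ≥0}
    (hq : ∀ m, ‖q (m + 1)‖ ≤ c ^ m) : (c : ℝ≥0∞)⁻¹ ≤ q.radius := by
  refine ENNReal.le_of_forall_nnreal_lt fun r hr => ?_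
  have hrc : r * c ≤ 1 := by exact_mod_cast ENNReal.le_inv_iff_mul_le.1 hr.le
  refine q.le_radius_of_eventually_le r ((eventually_ge_atTop 1).mono fun m hm => ?_)
  obtain ⟨m, rfl⟩ := Nat.exists_eq_add_of_le' hm
  calc ‖q (m + 1)‖ * (r : ℝ) ^ (m + 1) ≤ c ^ m * r ^ (m + 1) := by gcongr; exact hq m
    _ = (r * c : ℝ) ^ m * r := by ring
    _ ≤ r := mul_le_of_le_one_left r.2 (pow_le_one₀ (by positivity) (by exact_mod_cast hrc))

variable [CompleteSpace G] {f : E → G} {q : FormalMultilinearSeries 𝕜 E G} {a x : E}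
  {r : ℝ≥0∞} {c : ℝ}

lemma norm_fderiv_sub_fderiv_le (hf : HasFPowerSeriesOnBall f q a r)
    (hq : ∀ m, ‖q (m + 1)‖ ≤ c ^ m) (hx : x ∈ Metric.eball a r) (hc : c * ‖x - a‖ < 1) :
    ‖fderiv 𝕜 f x - fderiv 𝕜 f a‖ ≤ 1 / (1 - c * ‖x - a‖) ^ 2 - 1 := by
  have hc0 : 0 ≤ c := (norm_nonneg _).trans (by simpa using hq 1)
  have hu : ‖c * ‖x - a‖‖ < 1 := by rwa [Real.norm_of_nonneg (by positivity)]
  have hseries := (hasSum_nat_add_iff' 1).2 (hf.fderiv.hasSum_sub hx)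
  have hmajor := (hasSum_nat_add_iff' 1).2 (hasSum_succ_mul_geometric hu)
  have hterm (m : ℕ) : ‖q.derivSeries m fun _ => x - a‖ ≤ (m + 1) * (c * ‖x - a‖) ^ m :=
    calc ‖q.derivSeries m fun _ => x - a‖ ≤ ‖q.derivSeries m‖ * ‖x - a‖ ^ m := by
          simpa using (q.derivSeries m).le_opNorm fun _ => x - a
      _ ≤ (m + 1) * c ^ m * ‖x - a‖ ^ m := by
          gcongr
          exact (norm_derivSeries_le q m).trans (by gcongr; exact hq m)
      _ = (m + 1) * (c * ‖x - a‖) ^ m := by rw [mul_pow, mul_assoc]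
  have hbound := hseries.norm_le_of_bounded hmajor fun m => hterm (m + 1)
  simpa [hf.fderiv.coeff_zero] using hbound

lemma norm_fderiv_apply_sub_sub_le (hf : HasFPowerSeriesOnBall f q a r)
    (hq : ∀ m, ‖q (m + 1)‖ ≤ c ^ m) (hx : x ∈ Metric.eball a r) (hc : c * ‖x - a‖ < 1) :
    ‖fderiv 𝕜 f x (x - a) - (f x - f a)‖ ≤ c * ‖x - a‖ ^ 2 / (1 - c * ‖x - a‖) ^ 2 := by
  have hc0 : 0 ≤ c := (norm_nonneg _).trans (by simpa using hq 1)
  have hu : ‖c * ‖x - a‖‖ < 1 := by rwa [Real.norm_of_nonneg (by positivity)]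
  have hlin := (ContinuousLinearMap.apply 𝕜 G (x - a)).hasSum (hf.fderiv.hasSum_sub hx)
  have hincr := (hasSum_nat_add_iff' 1).2 (hf.hasSum_sub hx)
  have hmajor := (hasSum_coe_mul_geometric_of_norm_lt_one hu).mul_left ‖x - a‖
  rw [Finset.sum_range_one, hf.coeff_zero] at hincr
  have hbound := (hlin.sub hincr).norm_le_of_bounded hmajor fun m => ?_
  · exact hbound.trans_eq (by ring)
  · -- The `m`-th terms of the two series are multiples of the same vector.
    have hterm : ContinuousLinearMap.apply 𝕜 G (x - a) (q.derivSeries m fun _ => x - a)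
        - q (m + 1) (fun _ => x - a) = m • q (m + 1) fun _ => x - a := by
      rw [ContinuousLinearMap.apply_apply, q.derivSeries_apply_diag, succ_nsmul,
        add_sub_cancel_right]
    calc _ = ‖m • q (m + 1) fun _ => x - a‖ := by rw [hterm]
      _ ≤ m * ‖q (m + 1) fun _ => x - a‖ := norm_nsmul_le
      _ ≤ m * (c ^ m * ‖x - a‖ ^ (m + 1)) := by
          gcongr
          refine ((q (m + 1)).le_opNorm _).trans ?_
          simp only [Finset.prod_const, Finset.card_univ, Fintype.card_fin]
          gcongr
          exact hq m
      _ = ‖x - a‖ * (m * (c * ‖x - a‖) ^ m) := by ring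

end PowerSeries

section TaylorSeries

variable {E G : Type*} [NormedAddCommGroup E] [NormedSpace ℝ E] [NormedAddCommGroup G]
  [NormedSpace ℝ G]

/-- The Taylor series `∑ f⁽ᵐ⁾(a) / m!` of `f` at `a`. Among the power series of `f` at `a`, which
need not be unique, it is the one whose coefficients are symmetric multilinear maps. -/
noncomputable def taylorSeries (f : E → G) (a : E) : FormalMultilinearSeries ℝ E G :=
  fun m => (m.factorial : ℝ)⁻¹ • iteratedFDeriv ℝ m f a

lemma hasFPowerSeriesOnBall_taylorSeries [CompleteSpace G] {f : E → G} {a : E} {r : ℝ≥0∞}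
    (hr : 0 < r) (hf : AnalyticOnNhd ℝ f (Metric.eball a r))
    (hrad : r ≤ (taylorSeries f a).radius) :
    HasFPowerSeriesOnBall f (taylorSeries f a) a r := by
  set q := taylorSeries f a
  have hq : HasFPowerSeriesOnBall (fun x => q.sum (x - a)) q a r := by
    simpa using ((q.hasFPowerSeriesOnBall (hr.trans_le hrad)).mono hr hrad).comp_sub a
  refine hq.congr (hq.analyticOnNhd.eqOn_of_preconnected_of_eventuallyEq hf
    (convex_eball a r).isPreconnected (Metric.mem_eball_self hr) ?_)
  obtain ⟨p, ρ, hp⟩ := hf a (Metric.mem_eball_self hr)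
  filter_upwards [Metric.eball_mem_nhds a hp.r_pos] with x hx
  have hsum := hp.hasSum_iteratedFDeriv (y := x - a)
    (by simpa [Metric.mem_eball, edist_eq_enorm_sub] using hx)
  rw [add_sub_cancel] at hsum
  exact (tsum_congr fun m => by simp [q, taylorSeries]).trans hsum.tsum_eq

end TaylorSeries

lemma coe_mul_norm_sub_lt_one {E : Type*} [SeminormedAddCommGroup E] {x a : E} {r : ℝ≥0∞}
    {c : ℝ≥0} (hx : x ∈ Metric.eball a r) (hr : r ≤ (c : ℝ≥0∞)⁻¹) : c * ‖x - a‖ < 1 := by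
  have hlt : c * edist x a < 1 :=
    ENNReal.mul_lt_of_lt_div' ((Metric.mem_eball.1 hx).trans_le (by simpa using hr))
  rw [edist_eq_enorm_sub, enorm_eq_nnnorm] at hlt
  exact_mod_cast hlt

section Newton

variable {E G : Type*} [NormedAddCommGroup E] [NormedSpace ℝ E] [NormedAddCommGroup G]
  [NormedSpace ℝ G]

lemma isInvertible_of_norm_sub_one_lt_one [CompleteSpace E] {L : E →L[ℝ] E}
    (hL : ‖L - 1‖ < 1) : L.IsInvertible := by
  have hunit : IsUnit L := by
    exact sub_sub_cancel 1 L ▸ isUnit_one_sub_of_norm_lt_one (norm_sub_rev L 1 ▸ hL)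
  obtain ⟨e, rfl⟩ := hunit
  exact ⟨ContinuousLinearEquiv.unitsEquiv ℝ E e, rfl⟩

lemma norm_add_le_of_apply_eq_neg {L : E →L[ℝ] E} {h s b : E} {δ η : ℝ}
    (hL : ‖L - 1‖ ≤ δ) (hδ : δ < 1) (hη : ‖L h - b‖ ≤ η) (hs : L s = -b) :
    ‖h + s‖ ≤ η / (1 - δ) := by
  rw [le_div_iff₀ (by linarith)]
  have hresidual : L (h + s) = L h - b := by rw [map_add, hs, sub_eq_add_neg]
  have hdiff : ‖L (h + s) - (h + s)‖ ≤ δ * ‖h + s‖ := (L - 1).le_of_opNorm_le hL _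
  have htri := norm_le_norm_add_norm_sub (L (h + s)) (h + s)
  rw [hresidual] at htri hdiff
  linarith

/-- Smale's majorant condition: `F` is analytic on the ball of radius `r ≤ 1 / c` around `a`, its
derivative at `a` is invertible, and the higher Taylor coefficients of `F'(a)⁻¹ F` at `a` are
dominated by the powers of `c`. -/
structure HasSmaleBound (F : E → G) (a : E) (r : ℝ≥0∞) (c : ℝ≥0) : Prop where
  analyticOnNhd : AnalyticOnNhd ℝ F (Metric.eball a r)
  isInvertible : (fderiv ℝ F a).IsInvertible
  norm_le_pow : ∀ m > 1, ‖(m.factorial : ℝ)⁻¹ •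
    (fderiv ℝ F a).inverse.compContinuousMultilinearMap (iteratedFDeriv ℝ m F a)‖ ≤ c ^ (m - 1)
  le_inv : r ≤ (c : ℝ≥0∞)⁻¹

namespace HasSmaleBound

variable {F : E → G} {a x : E} {r : ℝ≥0∞} {c : ℝ≥0}

lemma differentiableAt (h : HasSmaleBound F a r c) (hx : x ∈ Metric.eball a r) :
    DifferentiableAt ℝ F x :=
  (h.analyticOnNhd x hx).differentiableAt

lemma fderiv_inverse_comp (h : HasSmaleBound F a r c) (hx : x ∈ Metric.eball a r) :
    fderiv ℝ ((fderiv ℝ F a).inverse ∘ F) x = (fderiv ℝ F a).inverse ∘L fderiv ℝ F x :=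
  ((fderiv ℝ F a).inverse.hasFDerivAt.comp x (h.differentiableAt hx).hasFDerivAt).fderiv

lemma fderiv_inverse_comp_self (h : HasSmaleBound F a r c) (hr : 0 < r) :
    fderiv ℝ ((fderiv ℝ F a).inverse ∘ F) a = 1 := by
  rw [h.fderiv_inverse_comp (Metric.mem_eball_self hr), h.isInvertible.inverse_comp_self]
  rfl

lemma norm_taylorSeries_le [CompleteSpace G] (h : HasSmaleBound F a r c) (hr : 0 < r) (m : ℕ) :
    ‖taylorSeries ((fderiv ℝ F a).inverse ∘ F) a (m + 1)‖ ≤ c ^ m := by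
  rcases m.eq_zero_or_pos with rfl | hm
  · simpa [taylorSeries, h.fderiv_inverse_comp_self hr, ContinuousLinearMap.one_def] using
      ContinuousLinearMap.norm_id_le (𝕜 := ℝ) (E := E)
  · rw [taylorSeries, ContinuousLinearMap.iteratedFDeriv_comp_left _ (n := (m + 1 : ℕ))
      (h.analyticOnNhd a (Metric.mem_eball_self hr)).contDiffAt le_rfl]
    exact h.norm_le_pow (m + 1) (Nat.succ_lt_succ hm)

variable [CompleteSpace E] [CompleteSpace G]

lemma hasFPowerSeriesOnBall (h : HasSmaleBound F a r c) (hr : 0 < r) :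
    HasFPowerSeriesOnBall ((fderiv ℝ F a).inverse ∘ F)
      (taylorSeries ((fderiv ℝ F a).inverse ∘ F) a) a r :=
  hasFPowerSeriesOnBall_taylorSeries hr
    (fun z hz => ((fderiv ℝ F a).inverse.analyticAt _).comp (h.analyticOnNhd z hz))
    (h.le_inv.trans (inv_le_radius_of_norm_le_pow (h.norm_taylorSeries_le hr)))

lemma norm_inverse_comp_fderiv_sub_one_le (h : HasSmaleBound F a r c)
    (hx : x ∈ Metric.eball a r) :
    ‖(fderiv ℝ F a).inverse ∘L fderiv ℝ F x - 1‖ ≤ 1 / (1 - c * ‖x - a‖) ^ 2 - 1 := by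
  have hr : 0 < r := bot_le.trans_lt hx
  rw [← h.fderiv_inverse_comp hx, ← h.fderiv_inverse_comp_self hr]
  exact norm_fderiv_sub_fderiv_le (h.hasFPowerSeriesOnBall hr) (h.norm_taylorSeries_le hr) hx
    (coe_mul_norm_sub_lt_one hx h.le_inv)

lemma isInvertible_fderiv (h : HasSmaleBound F a r c) (hx : x ∈ Metric.eball a r)
    (hd : 0 < 2 * (1 - c * ‖x - a‖) ^ 2 - 1) : (fderiv ℝ F x).IsInvertible := by
  have hcomp : ((fderiv ℝ F a).inverse ∘L fderiv ℝ F x).IsInvertible := by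
    refine isInvertible_of_norm_sub_one_lt_one
      ((h.norm_inverse_comp_fderiv_sub_one_le hx).trans_lt ?_)
    rw [sub_lt_iff_lt_add, div_lt_iff₀ (by linarith)]
    linarith
  have := h.isInvertible.comp hcomp
  rwa [← ContinuousLinearMap.comp_assoc, h.isInvertible.self_comp_inverse,
    ContinuousLinearMap.id_comp] at this

end HasSmaleBound

/-- The bound `γ t² / (2 (1 - γ t)² - 1)` for the error of a Newton step taken at distance `t` from
the zero. -/
noncomputable def newtonMajorant (γ t : ℝ) : ℝ :=
  γ * t ^ 2 / (2 * (1 - γ * t) ^ 2 - 1)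

lemma HasSmaleBound.norm_add_sub_le [CompleteSpace E] [CompleteSpace G] {F : E → G} {a x s : E}
    {r : ℝ≥0∞} {c : ℝ≥0} (h : HasSmaleBound F a r c) (hFa : F a = 0) (hx : x ∈ Metric.eball a r)
    (hd : 0 < 2 * (1 - c * ‖x - a‖) ^ 2 - 1) (hs : fderiv ℝ F x s = -F x) :
    ‖x + s - a‖ ≤ newtonMajorant c ‖x - a‖ := by
  have hr : 0 < r := bot_le.trans_lt hx
  have herror := norm_fderiv_apply_sub_sub_le (h.hasFPowerSeriesOnBall hr)
    (h.norm_taylorSeries_le hr) hx (coe_mul_norm_sub_lt_one hx h.le_inv)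
  have hpos : 0 < (1 - c * ‖x - a‖) ^ 2 := by linarith
  have hδ : 1 - (1 / (1 - c * ‖x - a‖) ^ 2 - 1) =
      (2 * (1 - c * ‖x - a‖) ^ 2 - 1) / (1 - c * ‖x - a‖) ^ 2 := by
    rw [sub_div, mul_div_cancel_right₀ _ hpos.ne']
    ring
  rw [h.fderiv_inverse_comp hx, Function.comp_apply, Function.comp_apply, hFa, map_zero,
    sub_zero] at herror
  have hnewton := norm_add_le_of_apply_eq_neg (s := s)
    (h.norm_inverse_comp_fderiv_sub_one_le hx) (sub_pos.1 (hδ ▸ div_pos hd hpos)) herror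
    (by rw [ContinuousLinearMap.comp_apply, hs, map_neg])
  rwa [hδ, div_div_div_cancel_right₀ hpos.ne', ← add_sub_right_comm] at hnewton

end Newton

section ScalarMajorant

/-- The scalar form of `t < r̄`: writing `u = γ t`, the inequality
`(1 + λ) u < (1 - λ) (2 (1 - u)² - 1)` holds for the `u` below the smaller root of
`2 (1 - λ) u² - (5 - 3 λ) u + (1 - λ)`, and `u < 1` excludes those above the larger one. -/
def SmaleAdmissible (γ lam t : ℝ) : Prop :=
  γ * t < 1 ∧ (1 + lam) * (γ * t) < (1 - lam) * (2 * (1 - γ * t) ^ 2 - 1)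

lemma lt_of_mul_lt_sub_sqrt {lam u : ℝ} (hlam1 : lam < 1)
    (hu : 4 * (1 - lam) * u < 5 - 3 * lam - √((5 - 3 * lam) ^ 2 - 8 * (1 - lam) ^ 2)) :
    (1 + lam) * u < (1 - lam) * (2 * (1 - u) ^ 2 - 1) := by
  have hsqrt : √((5 - 3 * lam) ^ 2 - 8 * (1 - lam) ^ 2) < 5 - 3 * lam - 4 * (1 - lam) * u := by
    linarith
  have hsq := (Real.sqrt_lt' ((Real.sqrt_nonneg _).trans_lt hsqrt)).1 hsqrt
  have hfactor : 0 < 8 * (1 - lam) * ((1 - lam) * (2 * (1 - u) ^ 2 - 1) - (1 + lam) * u) := by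
    linear_combination hsq
  exact sub_pos.1 (pos_of_mul_pos_right hfactor (by linarith))

/-- If `‖y - a‖ ≤ N` bounds the exact Newton iterate `y`, then `N + t` bounds the Newton step and
the CondG output `w` satisfies `‖w - a‖² ≤ N² + l² (N + t)²`, where `l = √(2 θ)`. -/
lemma le_add_mul_of_sq_le {w N l lam t : ℝ} (ht : 0 ≤ t) (hN : 0 ≤ N) (hl : 0 ≤ l)
    (hlam : l ≤ lam) (hNt : (1 + lam) * N ≤ (1 - lam) * t)
    (hw : w ^ 2 ≤ N ^ 2 + l ^ 2 * (N + t) ^ 2) : w ≤ N + l * t := by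
  have hlamN : 0 ≤ lam * N := mul_nonneg (hl.trans hlam) hN
  have hslack : l * (N + 2 * t) ≤ 2 * t :=
    calc l * (N + 2 * t) ≤ lam * (N + 2 * t) := by gcongr
      _ ≤ 2 * t := by linarith
  have hsq : N ^ 2 + l ^ 2 * (N + t) ^ 2 ≤ (N + l * t) ^ 2 := by
    linear_combination l * N * hslack
  exact le_of_sq_le_sq (hw.trans hsq) (by positivity)

variable {γ : ℝ≥0} {lam t t₀ : ℝ}

lemma two_mul_one_sub_sq_sub_one_anti (ht : t ≤ t₀) (ht₀ : γ * t₀ < 1) :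
    2 * (1 - γ * t₀) ^ 2 - 1 ≤ 2 * (1 - γ * t) ^ 2 - 1 := by
  have : γ * t ≤ γ * t₀ := by gcongr
  have : 0 ≤ 1 - γ * t₀ := by linarith
  gcongr

lemma SmaleAdmissible.mono (h : SmaleAdmissible γ lam t₀) (hlam0 : 0 ≤ lam) (hlam1 : lam < 1)
    (ht : t ≤ t₀) : SmaleAdmissible γ lam t := by
  have hγt : γ * t ≤ γ * t₀ := by gcongr
  refine ⟨hγt.trans_lt h.1, ?_⟩
  calc (1 + lam) * (γ * t) ≤ (1 + lam) * (γ * t₀) := by gcongr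
    _ < (1 - lam) * (2 * (1 - γ * t₀) ^ 2 - 1) := h.2
    _ ≤ (1 - lam) * (2 * (1 - γ * t) ^ 2 - 1) :=
      mul_le_mul_of_nonneg_left (two_mul_one_sub_sq_sub_one_anti ht h.1) (by linarith)

lemma SmaleAdmissible.denominator_pos (h : SmaleAdmissible γ lam t) (hlam0 : 0 ≤ lam)
    (hlam1 : lam < 1) (ht : 0 ≤ t) : 0 < 2 * (1 - γ * t) ^ 2 - 1 :=
  pos_of_mul_pos_right (lt_of_le_of_lt (by positivity) h.2) (by linarith)

lemma newtonMajorant_nonneg (hd : 0 < 2 * (1 - γ * t) ^ 2 - 1) : 0 ≤ newtonMajorant γ t :=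
  div_nonneg (by positivity) hd.le

lemma newtonMajorant_le_div_mul_sq (ht : t ≤ t₀) (ht₀ : γ * t₀ < 1)
    (hd : 0 < 2 * (1 - γ * t₀) ^ 2 - 1) :
    newtonMajorant γ t ≤ γ / (2 * (1 - γ * t₀) ^ 2 - 1) * t ^ 2 := by
  rw [newtonMajorant, div_mul_eq_mul_div]
  exact div_le_div_of_nonneg_left (by positivity) hd (two_mul_one_sub_sq_sub_one_anti ht ht₀)

lemma newtonMajorant_le_newtonMajorant (ht0 : 0 ≤ t) (ht : t ≤ t₀) (ht₀ : γ * t₀ < 1)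
    (hd : 0 < 2 * (1 - γ * t₀) ^ 2 - 1) : newtonMajorant γ t ≤ newtonMajorant γ t₀ := by
  refine (newtonMajorant_le_div_mul_sq ht ht₀ hd).trans ?_
  rw [newtonMajorant, div_mul_eq_mul_div]
  gcongr

lemma SmaleAdmissible.newtonMajorant_le (h : SmaleAdmissible γ lam t) (hlam0 : 0 ≤ lam)
    (hlam1 : lam < 1) (ht : 0 ≤ t) : (1 + lam) * newtonMajorant γ t ≤ (1 - lam) * t := by
  rw [newtonMajorant, ← mul_div_assoc, div_le_iff₀ (h.denominator_pos hlam0 hlam1 ht)]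
  linear_combination t * h.2.le

lemma SmaleAdmissible.linear_rate_lt_one (h : SmaleAdmissible γ lam t) (hlam0 : 0 ≤ lam)
    (hlam1 : lam < 1) (ht : 0 ≤ t) : γ / (2 * (1 - γ * t) ^ 2 - 1) * t + lam < 1 := by
  rw [← lt_sub_iff_add_lt, div_mul_eq_mul_div, div_lt_iff₀ (h.denominator_pos hlam0 hlam1 ht)]
  calc γ * t ≤ (1 + lam) * (γ * t) := le_mul_of_one_le_left (by positivity) (by linarith)
    _ < _ := h.2

lemma smaleSeq_succ (θ : ℕ → ℝ) (k : ℕ) : smaleSeq γ lam θ t₀ (k + 1) =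
    (1 + lam) * newtonMajorant γ (smaleSeq γ lam θ t₀ k) + √(2 * θ k) * smaleSeq γ lam θ t₀ k := by
  rw [smaleSeq, newtonMajorant, ← mul_div_assoc, mul_assoc (1 + lam)]

lemma SmaleAdmissible.smaleSeq_mem_Icc (h : SmaleAdmissible γ lam t₀) (hlam0 : 0 ≤ lam)
    (hlam1 : lam < 1) (ht₀ : 0 ≤ t₀) {θ : ℕ → ℝ} (hθ : ∀ k, √(2 * θ k) ≤ lam) (k : ℕ) :
    smaleSeq γ lam θ t₀ k ∈ Set.Icc 0 t₀ := by
  induction k with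
  | zero => exact ⟨ht₀, le_rfl⟩
  | succ k ih =>
    obtain ⟨hnonneg, hle⟩ := ih
    have hadm := h.mono hlam0 hlam1 hle
    have hmajorant := newtonMajorant_nonneg (hadm.denominator_pos hlam0 hlam1 hnonneg)
    have hcontr := hadm.newtonMajorant_le hlam0 hlam1 hnonneg
    have hprojection := mul_le_mul_of_nonneg_right (hθ k) hnonneg
    rw [smaleSeq_succ]
    exact ⟨by positivity, by linarith⟩

end ScalarMajorant

section SmaleRadius

variable {n : ℕ} {F : RSpace n → RSpace n} {Ω : Set (RSpace n)} {a x : RSpace n} {γ : ℝ≥0}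
  {lam : ℝ}

lemma norm_le_smaleGamma_pow (hγ : smaleGamma F a = γ) {m : ℕ} (hm : 1 < m) :
    ‖(m.factorial : ℝ)⁻¹ • (fderiv ℝ F a).inverse.compContinuousMultilinearMap
        (iteratedFDeriv ℝ m F a)‖ ≤ γ ^ (m - 1) := by
  have hle := (le_iSup₂_of_le (f := fun (m : ℕ) (_ : 1 < m) =>
    ‖((m.factorial : ℝ)⁻¹ • (fderiv ℝ F a).inverse.compContinuousMultilinearMap
        (iteratedFDeriv ℝ m F a))‖ₑ ^ (1 / ((m : ℝ) - 1))) m hm le_rfl).trans_eq hγ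
  have hpos : (0 : ℝ) < (m - 1 : ℕ) := by exact_mod_cast Nat.sub_pos_of_lt hm
  rw [← Nat.cast_pred (zero_lt_one.trans hm), one_div, ENNReal.rpow_inv_le_iff hpos,
    ENNReal.rpow_natCast, enorm_eq_nnnorm] at hle
  exact_mod_cast hle

lemma exists_hasSmaleBound_of_mem_eball_kappa (hF : AnalyticOnNhd ℝ F Ω)
    (hinv : (fderiv ℝ F a).IsInvertible) (hγ : smaleGamma F a = γ)
    (hx : x ∈ Metric.eball a (kappa Ω a (1 / γ))) :
    ∃ r, x ∈ Metric.eball a r ∧ HasSmaleBound F a r γ := by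
  obtain ⟨r, ⟨hr, hball⟩, hxr⟩ := lt_sSup_iff.1 (Metric.mem_eball.1 hx)
  exact ⟨r, hxr, hF.mono hball, hinv, fun m hm => norm_le_smaleGamma_pow hγ hm,
    by simpa using hr.le⟩

lemma mul_norm_sub_lt_of_mem_eball_smaleRadius (hlam1 : lam < 1)
    (hx : x ∈ Metric.eball a (smaleRadius Ω a γ lam)) :
    4 * (1 - lam) * (γ * ‖x - a‖) < 5 - 3 * lam - √((5 - 3 * lam) ^ 2 - 8 * (1 - lam) ^ 2) := by
  have hlt := ENNReal.mul_lt_of_lt_div ((Metric.mem_eball.1 hx).trans_le (min_le_right _ _))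
  rw [edist_eq_enorm_sub] at hlt
  have := ENNReal.toReal_lt_of_lt_ofReal hlt
  rw [ENNReal.toReal_mul, ENNReal.toReal_mul, toReal_enorm, ENNReal.coe_toReal,
    ENNReal.toReal_ofReal (by linarith)] at this
  linarith

lemma exists_hasSmaleBound_and_smaleAdmissible (hF : AnalyticOnNhd ℝ F Ω)
    (hinv : (fderiv ℝ F a).IsInvertible) (hγ : smaleGamma F a = γ) (hlam1 : lam < 1)
    (hx : x ∈ Metric.eball a (smaleRadius Ω a γ lam)) :
    ∃ r, x ∈ Metric.eball a r ∧ HasSmaleBound F a r γ ∧ SmaleAdmissible γ lam ‖x - a‖ := by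
  obtain ⟨r, hxr, hr⟩ := exists_hasSmaleBound_of_mem_eball_kappa hF hinv hγ
    (Metric.eball_subset_eball (min_le_left _ _) hx)
  exact ⟨r, hxr, hr, coe_mul_norm_sub_lt_one hxr hr.le_inv,
    lt_of_mul_lt_sub_sqrt hlam1 (mul_norm_sub_lt_of_mem_eball_smaleRadius hlam1 hx)⟩

end SmaleRadius

lemma closedBall_norm_sub_subset_eball {E : Type*} [SeminormedAddCommGroup E] {a x : E} {r : ℝ≥0∞}
    (hx : x ∈ Metric.eball a r) : Metric.closedBall a ‖x - a‖ ⊆ Metric.eball a r := by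
  rw [← Metric.closedEBall_ofReal (norm_nonneg _), ofReal_norm, ← edist_eq_enorm_sub]
  exact fun y hy => (Metric.mem_closedEBall.1 hy).trans_lt hx

section NewtonCondG

variable {n : ℕ} {F : RSpace n → RSpace n} {C : Set (RSpace n)} {a x x' s : RSpace n}
  {r : ℝ≥0∞} {γ : ℝ≥0} {lam t₀ θ : ℝ}

/-- The hypotheses under which every step of the Newton-CondG method with `√(2 θ) ≤ λ` contracts
towards the zero `a` of `F` on `C ∩ closedBall a t₀`. -/
structure IsNewtonCondGBasin (F : RSpace n → RSpace n) (C : Set (RSpace n)) (a : RSpace n)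
    (r : ℝ≥0∞) (γ : ℝ≥0) (lam t₀ : ℝ) : Prop where
  convex : Convex ℝ C
  isCompact : IsCompact C
  mem : a ∈ C
  map_eq_zero : F a = 0
  hasSmaleBound : HasSmaleBound F a r γ
  lam_nonneg : 0 ≤ lam
  lam_lt_one : lam < 1
  smaleAdmissible : SmaleAdmissible γ lam t₀
  closedBall_subset : Metric.closedBall a t₀ ⊆ Metric.eball a r

namespace IsNewtonCondGBasin

lemma smaleAdmissible_norm (h : IsNewtonCondGBasin F C a r γ lam t₀)
    (hx : x ∈ Metric.closedBall a t₀) : SmaleAdmissible γ lam ‖x - a‖ :=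
  h.smaleAdmissible.mono h.lam_nonneg h.lam_lt_one (mem_closedBall_iff_norm.1 hx)

lemma denominator_pos (h : IsNewtonCondGBasin F C a r γ lam t₀)
    (hx : x ∈ Metric.closedBall a t₀) : 0 < 2 * (1 - γ * ‖x - a‖) ^ 2 - 1 :=
  (h.smaleAdmissible_norm hx).denominator_pos h.lam_nonneg h.lam_lt_one (norm_nonneg _)

lemma isInvertible_fderiv (h : IsNewtonCondGBasin F C a r γ lam t₀)
    (hx : x ∈ Metric.closedBall a t₀) : (fderiv ℝ F x).IsInvertible :=
  h.hasSmaleBound.isInvertible_fderiv (h.closedBall_subset hx) (h.denominator_pos hx)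

lemma norm_newton_sub_le (h : IsNewtonCondGBasin F C a r γ lam t₀)
    (hx : x ∈ Metric.closedBall a t₀) (hs : fderiv ℝ F x s = -F x) :
    ‖x + s - a‖ ≤ newtonMajorant γ ‖x - a‖ :=
  h.hasSmaleBound.norm_add_sub_le h.map_eq_zero (h.closedBall_subset hx) (h.denominator_pos hx) hs

lemma newtonMajorant_le (h : IsNewtonCondGBasin F C a r γ lam t₀)
    (hx : x ∈ Metric.closedBall a t₀) :
    (1 + lam) * newtonMajorant γ ‖x - a‖ ≤ (1 - lam) * ‖x - a‖ :=
  (h.smaleAdmissible_norm hx).newtonMajorant_le h.lam_nonneg h.lam_lt_one (norm_nonneg _)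

lemma norm_condG_sub_le (h : IsNewtonCondGBasin F C a r γ lam t₀)
    (hx : x ∈ C ∩ Metric.closedBall a t₀) (hθ0 : 0 ≤ θ) (hθ : √(2 * θ) ≤ lam)
    (hs : fderiv ℝ F x s = -F x) (hx' : IsCondGOutput C (x + s) x (θ * ‖s‖ ^ 2) x') :
    ‖x' - a‖ ≤ newtonMajorant γ ‖x - a‖ + √(2 * θ) * ‖x - a‖ := by
  have hnewton := h.norm_newton_sub_le hx.2 hs
  have hstep : ‖s‖ ≤ newtonMajorant γ ‖x - a‖ + ‖x - a‖ :=
    calc ‖s‖ = ‖(x + s - a) - (x - a)‖ := by congr 1; abel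
      _ ≤ ‖x + s - a‖ + ‖x - a‖ := norm_sub_le _ _
      _ ≤ _ := by gcongr
  refine le_add_mul_of_sq_le (norm_nonneg _) ((norm_nonneg _).trans hnewton)
    (Real.sqrt_nonneg _) hθ (h.newtonMajorant_le hx.2) ?_
  calc ‖x' - a‖ ^ 2 ≤ ‖x + s - a‖ ^ 2 + 2 * (θ * ‖s‖ ^ 2) :=
        hx'.norm_sub_sq_le h.convex h.isCompact (by positivity) hx.1 h.mem
    _ = ‖x + s - a‖ ^ 2 + √(2 * θ) ^ 2 * ‖s‖ ^ 2 := by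
        rw [Real.sq_sqrt (by positivity), mul_assoc]
    _ ≤ _ := by gcongr

lemma norm_step_sub_le (h : IsNewtonCondGBasin F C a r γ lam t₀)
    (hx : x ∈ C ∩ Metric.closedBall a t₀) (hθ0 : 0 ≤ θ) (hθ : √(2 * θ) ≤ lam)
    (hx' : NewtonCondGStep F C θ x x') :
    ‖x' - a‖ ≤ newtonMajorant γ ‖x - a‖ + √(2 * θ) * ‖x - a‖ := by
  rcases hx' with ⟨hFx, rfl⟩ | ⟨-, s, hs, hout⟩
  · have hnewton := h.norm_newton_sub_le hx.2 (s := 0) (by rw [map_zero, hFx, neg_zero])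
    rw [add_zero] at hnewton
    exact hnewton.trans (le_add_of_nonneg_right (by positivity))
  · exact h.norm_condG_sub_le hx hθ0 hθ hs hout

lemma norm_step_sub_le_norm_sub (h : IsNewtonCondGBasin F C a r γ lam t₀)
    (hx : x ∈ C ∩ Metric.closedBall a t₀) (hθ0 : 0 ≤ θ) (hθ : √(2 * θ) ≤ lam)
    (hx' : NewtonCondGStep F C θ x x') : ‖x' - a‖ ≤ ‖x - a‖ := by
  have hmajorant := newtonMajorant_nonneg (h.denominator_pos hx.2)
  calc ‖x' - a‖ ≤ newtonMajorant γ ‖x - a‖ + √(2 * θ) * ‖x - a‖ := h.norm_step_sub_le hx hθ0 hθ hx'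
    _ ≤ (1 + lam) * newtonMajorant γ ‖x - a‖ + lam * ‖x - a‖ := by
        gcongr
        exact le_mul_of_one_le_left hmajorant (by linarith [h.lam_nonneg])
    _ ≤ ‖x - a‖ := by linarith [h.newtonMajorant_le hx.2]

lemma mem_of_step (h : IsNewtonCondGBasin F C a r γ lam t₀)
    (hx : x ∈ C ∩ Metric.closedBall a t₀) (hθ0 : 0 ≤ θ) (hθ : √(2 * θ) ≤ lam)
    (hx' : NewtonCondGStep F C θ x x') : x' ∈ C ∩ Metric.closedBall a t₀ := by
  refine ⟨?_, mem_closedBall_iff_norm.2 ((h.norm_step_sub_le_norm_sub hx hθ0 hθ hx').trans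
    (mem_closedBall_iff_norm.1 hx.2))⟩
  rcases hx' with ⟨-, rfl⟩ | ⟨-, s, -, hout⟩
  · exact hx.1
  · exact hout.mem h.convex h.isCompact (by positivity) hx.1

lemma condGWellDefined (h : IsNewtonCondGBasin F C a r γ lam t₀) (hx : x ∈ C) (hθ0 : 0 ≤ θ) :
    CondGWellDefined C (x + s) x (θ * ‖s‖ ^ 2) :=
  condGWellDefined_of_isCompact h.convex h.isCompact (by positivity) hx

lemma exists_step (h : IsNewtonCondGBasin F C a r γ lam t₀)
    (hx : x ∈ C ∩ Metric.closedBall a t₀) (hθ0 : 0 ≤ θ) : ∃ x', NewtonCondGStep F C θ x x' := by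
  by_cases hFx : F x = 0
  · exact ⟨x, Or.inl ⟨hFx, rfl⟩⟩
  · obtain ⟨s, hs⟩ := (h.isInvertible_fderiv hx.2).bijective.surjective (-F x)
    obtain ⟨x', hx'⟩ := (h.condGWellDefined (s := s) hx.1 hθ0).exists_isCondGOutput
    exact ⟨x', Or.inr ⟨hFx, s, hs, hx'⟩⟩

section Sequence

variable {θ : ℕ → ℝ} {x : ℕ → RSpace n}

lemma mem_of_forall_lt_step (h : IsNewtonCondGBasin F C a r γ lam t₀) (hθ0 : ∀ k, 0 ≤ θ k)
    (hθ : ∀ k, √(2 * θ k) ≤ lam) (hx0 : x 0 ∈ C ∩ Metric.closedBall a t₀) {N : ℕ}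
    (hstep : ∀ k < N, NewtonCondGStep F C (θ k) (x k) (x (k + 1))) :
    x N ∈ C ∩ Metric.closedBall a t₀ := by
  induction N with
  | zero => exact hx0
  | succ N ih =>
    exact h.mem_of_step (ih fun k hk => hstep k (hk.trans N.lt_succ_self)) (hθ0 N) (hθ N)
      (hstep N N.lt_succ_self)

lemma exists_seq (h : IsNewtonCondGBasin F C a r γ lam t₀) (hθ0 : ∀ k, 0 ≤ θ k)
    (hθ : ∀ k, √(2 * θ k) ≤ lam) {x₀ : RSpace n} (hx₀ : x₀ ∈ C ∩ Metric.closedBall a t₀) :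
    ∃ x : ℕ → RSpace n, x 0 = x₀ ∧ ∀ k, NewtonCondGStep F C (θ k) (x k) (x (k + 1)) := by
  refine exists_seq_of_forall_mem_exists (fun k x hx => ?_) hx₀
  obtain ⟨x', hx'⟩ := h.exists_step hx (hθ0 k)
  exact ⟨x', h.mem_of_step hx (hθ0 k) (hθ k) hx', hx'⟩

lemma norm_succ_sub_le (h : IsNewtonCondGBasin F C a r γ lam ‖x 0 - a‖) (hθ0 : ∀ k, 0 ≤ θ k)
    (hθ : ∀ k, √(2 * θ k) ≤ lam) (hx : ∀ k, x k ∈ C ∩ Metric.closedBall a ‖x 0 - a‖)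
    (hstep : ∀ k, NewtonCondGStep F C (θ k) (x k) (x (k + 1))) (k : ℕ) :
    ‖x (k + 1) - a‖ ≤ γ / (2 * (1 - γ * ‖x 0 - a‖) ^ 2 - 1) * ‖x k - a‖ ^ 2 +
      √(2 * θ k) * ‖x k - a‖ := by
  refine (h.norm_step_sub_le (hx k) (hθ0 k) (hθ k) (hstep k)).trans ?_
  gcongr
  exact newtonMajorant_le_div_mul_sq (mem_closedBall_iff_norm.1 (hx k).2) h.smaleAdmissible.1
    (h.denominator_pos (hx 0).2)

lemma tendsto (h : IsNewtonCondGBasin F C a r γ lam ‖x 0 - a‖) (hθ0 : ∀ k, 0 ≤ θ k)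
    (hθ : ∀ k, √(2 * θ k) ≤ lam) (hx : ∀ k, x k ∈ C ∩ Metric.closedBall a ‖x 0 - a‖)
    (hstep : ∀ k, NewtonCondGStep F C (θ k) (x k) (x (k + 1))) : Tendsto x atTop (𝓝 a) := by
  have hd := h.denominator_pos (hx 0).2
  have hrate := h.smaleAdmissible.linear_rate_lt_one h.lam_nonneg h.lam_lt_one (norm_nonneg _)
  have hsummable : Summable fun k => x k - a := by
    refine summable_of_ratio_norm_eventually_le hrate (.of_forall fun k => ?_)
    calc ‖x (k + 1) - a‖ ≤ γ / (2 * (1 - γ * ‖x 0 - a‖) ^ 2 - 1) * ‖x k - a‖ ^ 2 +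
          √(2 * θ k) * ‖x k - a‖ := h.norm_succ_sub_le hθ0 hθ hx hstep k
      _ = (γ / (2 * (1 - γ * ‖x 0 - a‖) ^ 2 - 1) * ‖x k - a‖ + √(2 * θ k)) * ‖x k - a‖ := by ring
      _ ≤ (γ / (2 * (1 - γ * ‖x 0 - a‖) ^ 2 - 1) * ‖x 0 - a‖ + lam) * ‖x k - a‖ := by
          gcongr
          · exact mem_closedBall_iff_norm.1 (hx k).2
          · exact hθ k
  exact tendsto_sub_nhds_zero_iff.1 hsummable.tendsto_atTop_zero

lemma norm_sub_le_smaleSeq (h : IsNewtonCondGBasin F C a r γ lam ‖x 0 - a‖)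
    (hθ0 : ∀ k, 0 ≤ θ k) (hθ : ∀ k, √(2 * θ k) ≤ lam)
    (hx : ∀ k, x k ∈ C ∩ Metric.closedBall a ‖x 0 - a‖)
    (hstep : ∀ k, NewtonCondGStep F C (θ k) (x k) (x (k + 1))) (k : ℕ) :
    ‖x k - a‖ ≤ smaleSeq γ lam θ ‖x 0 - a‖ k := by
  induction k with
  | zero => exact le_rfl
  | succ k ih =>
    obtain ⟨ht0, ht⟩ := h.smaleAdmissible.smaleSeq_mem_Icc h.lam_nonneg h.lam_lt_one
      (norm_nonneg _) hθ k
    have hadm := h.smaleAdmissible.mono h.lam_nonneg h.lam_lt_one ht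
    have hd := hadm.denominator_pos h.lam_nonneg h.lam_lt_one ht0
    rw [smaleSeq_succ]
    refine (h.norm_step_sub_le (hx k) (hθ0 k) (hθ k) (hstep k)).trans ?_
    gcongr
    calc newtonMajorant γ ‖x k - a‖ ≤ newtonMajorant γ (smaleSeq γ lam θ ‖x 0 - a‖ k) :=
          newtonMajorant_le_newtonMajorant (norm_nonneg _) ih hadm.1 hd
      _ ≤ _ := le_mul_of_one_le_left (newtonMajorant_nonneg hd) (by linarith [h.lam_nonneg])

end Sequence

end IsNewtonCondGBasin

end NewtonCondG

theorem theorem4p2 {n : ℕ} (Ω C : Set (RSpace n)) (F : RSpace n → RSpace n) (xs : RSpace n)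
    (hΩ : IsOpen Ω) (hCΩ : C ⊆ Ω) (hCconv : Convex ℝ C) (hCcomp : IsCompact C)
    (hF : AnalyticOnNhd ℝ F Ω)
    (hxs : xs ∈ C) (hFxs : F xs = 0) (hinv : (fderiv ℝ F xs).IsInvertible)
    (hγ : smaleGamma F xs < ∞)
    (lam : ℝ) (hlam0 : 0 ≤ lam) (hlam1 : lam < 1)
    (θ : ℕ → ℝ) (hθ : ∀ k, 0 ≤ θ k ∧ θ k ≤ lam ^ 2 / 2)
    (x₀ : RSpace n) (hx₀C : x₀ ∈ C)
    (hx₀B : x₀ ∈ Metric.eball xs (smaleRadius Ω xs (smaleGamma F xs) lam)) (hx₀ : x₀ ≠ xs) :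
    -- The method never breaks down, whatever choices have been made before.
    (∀ (N : ℕ) (x : ℕ → RSpace n), x 0 = x₀ →
      (∀ k < N, NewtonCondGStep F C (θ k) (x k) (x (k + 1))) →
      (fderiv ℝ F (x N)).IsInvertible ∧
      (F (x N) ≠ 0 → ∀ s : RSpace n, fderiv ℝ F (x N) s = -F (x N) →
        s ≠ 0 ∧ CondGWellDefined C (x N + s) (x N) (θ N * ‖s‖ ^ 2))) ∧
    -- It generates a sequence.
    (∃ x : ℕ → RSpace n, x 0 = x₀ ∧ ∀ k, NewtonCondGStep F C (θ k) (x k) (x (k + 1))) ∧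
    -- Every sequence that it generates has the asserted properties.
    (∀ x : ℕ → RSpace n, x 0 = x₀ →
      (∀ k, NewtonCondGStep F C (θ k) (x k) (x (k + 1))) →
      (∀ k, x k ∈ Metric.eball xs (smaleRadius Ω xs (smaleGamma F xs) lam) ∩ C) ∧
      Tendsto x atTop (𝓝 xs) ∧
      (∀ k, ‖x (k + 1) - xs‖ ≤
        (smaleGamma F xs).toReal / (2 * (1 - (smaleGamma F xs).toReal * ‖x₀ - xs‖) ^ 2 - 1)
            * ‖x k - xs‖ ^ 2
          + √(2 * θ k) * ‖x k - xs‖) ∧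
      (∀ k, ‖x (k + 1) - xs‖ ≤
        smaleSeq (smaleGamma F xs).toReal lam θ ‖x₀ - xs‖ (k + 1))) := by
  obtain ⟨γ, hγ⟩ : ∃ γ : ℝ≥0, smaleGamma F xs = γ := ⟨_, (ENNReal.coe_toNNReal hγ.ne).symm⟩
  simp only [hγ, ENNReal.coe_toReal] at hx₀B ⊢
  have hθ0 (k : ℕ) : 0 ≤ θ k := (hθ k).1
  have hθlam (k : ℕ) : √(2 * θ k) ≤ lam := Real.sqrt_le_iff.2 ⟨hlam0, by linarith [(hθ k).2]⟩
  obtain ⟨r, hx₀r, hsmale, hadm⟩ :=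
    exists_hasSmaleBound_and_smaleAdmissible hF hinv hγ hlam1 hx₀B
  have hbasin : IsNewtonCondGBasin F C xs r γ lam ‖x₀ - xs‖ := ⟨hCconv, hCcomp, hxs, hFxs, hsmale,
    hlam0, hlam1, hadm, closedBall_norm_sub_subset_eball hx₀r⟩
  have hx₀K : x₀ ∈ C ∩ Metric.closedBall xs ‖x₀ - xs‖ := ⟨hx₀C, mem_closedBall_iff_norm.2 le_rfl⟩
  refine ⟨?_, hbasin.exists_seq hθ0 hθlam hx₀K, ?_⟩
  · rintro N x rfl hstep
    have hx := hbasin.mem_of_forall_lt_step hθ0 hθlam hx₀K hstep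
    refine ⟨hbasin.isInvertible_fderiv hx.2, fun hFx s hs => ⟨?_, ?_⟩⟩
    · rintro rfl
      exact hFx (neg_eq_zero.1 (by rw [← hs, map_zero]))
    · exact hbasin.condGWellDefined hx.1 (hθ0 N)
  · rintro x rfl hstep
    have hx (k : ℕ) := hbasin.mem_of_forall_lt_step hθ0 hθlam hx₀K fun j (_ : j < k) => hstep j
    exact ⟨fun k => ⟨closedBall_norm_sub_subset_eball hx₀B (hx k).2, (hx k).1⟩,
      hbasin.tendsto hθ0 hθlam hx hstep, hbasin.norm_succ_sub_le hθ0 hθlam hx hstep,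
      fun k => hbasin.norm_sub_le_smaleSeq hθ0 hθlam hx hstep (k + 1)⟩
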